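/- For irrational $\alpha\in(0,1)$ let $T x=\frac1x-\left[\frac1x\right]$ be the Gauss map, let $a_n(\alpha)=\left[\frac1{T^{n-1}\alpha}\right]$ for $n\ge 1$ (the partial quotients of $\alpha=[0;a_1,a_2,\ldots]$), and define $$p_0=1,\quad p_1=0,\quad p_{n+1}=a_np_n+p_{n-1};\qquad q_0=0,\quad q_1=1,\quad q_{n+1}=a_nq_n+q_{n-1}\qquad(n\ge 1),$$ $$d_n(\alpha)=|q_n(\alpha)\alpha-p_n(\alpha)|\qquad(n\ge 0).$$ For $\epsilon\in(0,1]$ put $N(\alpha,\epsilon)=\inf\{n\ge 0 : d_n(\alpha)\le\epsilon\}$ and $\delta_n(\alpha,\epsilon)=d_n(\alpha)/\epsilon$. For $n<0$, let $d_n(\alpha)$ be given arbitrary nonnegative values; these enter below only for those $\epsilon$ with $N(\alpha,\epsilon)<m$. **Theorem 5.2.** Let $m\ge 0$ and let $f:[0,\infty)^{m+1}\to\mathbf{R}$ be bounded and Borel measurable. Then there exists $L_m(f)\in\mathbf{R}$, independent of $\alpha$ (and of the values chosen for $d_n$ with $n<0$), such that for Lebesgue-almost every $\alpha\in(0,1)$,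 both integrands below are integrable on $[\eta,1]$ for every $\eta\in(0,1)$ and, as $\eta\to0^+$, $$\frac1{\ln(1/\eta)}\int_\eta^1 f\bigl(\delta_N(\alpha,\epsilon),\delta_{N-1}(\alpha,\epsilon),\ldots,\delta_{N-m}(\alpha,\epsilon)\bigr)\,\frac{d\epsilon}{\epsilon}\longrightarrow L_m(f)$$ and $$\frac1{\ln(1/\eta)}\int_\eta^1(-1)^{N}f\bigl(\delta_N(\alpha,\epsilon),\delta_{N-1}(\alpha,\epsilon),\ldots,\delta_{N-m}(\alpha,\epsilon)\bigr)\,\frac{d\epsilon}{\epsilon}\longrightarrow 0,$$ where $N=N(\alpha,\epsilon)$. The exceptional null set of $\alpha$ may depend on $m$ and $f$, but not on the values chosen for $d_n$ with $n<0$. -/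

import Mathlib

open MeasureTheory Filter Topology Set

noncomputable section

namespace ContFracErgodic

/-- The Gauss map `x ↦ 1/x - [1/x]`. -/
def gaussMap (x : ℝ) : ℝ := 1 / x - ⌊1 / x⌋

/-- The partial quotients `a_n(α) = [1 / T^(n-1) α]`, meaningful for `n ≥ 1` and irrational
`α ∈ (0,1)`. -/
def partialQuot (α : ℝ) (n : ℕ) : ℤ := ⌊1 / (gaussMap^[n - 1] α)⌋

/-- `p_0 = 1`, `p_1 = 0`, `p_{n+1} = a_n p_n + p_{n-1}` for `n ≥ 1`. -/
def num (α : ℝ) : ℕ → ℤ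
  | 0 => 1
  | 1 => 0
  | n + 2 => partialQuot α (n + 1) * num α (n + 1) + num α n

/-- `q_0 = 0`, `q_1 = 1`, `q_{n+1} = a_n q_n + q_{n-1}` for `n ≥ 1`. -/
def den (α : ℝ) : ℕ → ℤ
  | 0 => 0
  | 1 => 1
  | n + 2 => partialQuot α (n + 1) * den α (n + 1) + den α n

/-- `d_n(α) = |q_n(α) α - p_n(α)|`. -/
def dist (α : ℝ) (n : ℕ) : ℝ := |(den α n : ℝ) * α - (num α n : ℝ)|

/-- `N(α, ε) = inf {n ≥ 0 | d_n(α) ≤ ε}`. -/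
def firstIndex (α ε : ℝ) : ℕ := sInf {n : ℕ | dist α n ≤ ε}

/-- The sequence `d_n(α)` continued to negative indices by prescribed values:
`d_{-1} = c 0`, `d_{-2} = c 1`, and so on. -/
def extDist (c : ℕ → ℝ) (α : ℝ) : ℤ → ℝ
  | Int.ofNat n => dist α n
  | Int.negSucc k => c k

/-- `δ_n(α, ε) = d_n(α) / ε`. -/
def delta (c : ℕ → ℝ) (α ε : ℝ) (n : ℤ) : ℝ := extDist c α n / ε

/-- The vector `(δ_N, δ_{N-1}, …, δ_{N-m})` with `N = N(α, ε)`; the values `c` matter only when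
`N < m`. -/
def window (m : ℕ) (c : ℕ → ℝ) (α ε : ℝ) : Fin (m + 1) → ℝ :=
  fun i => delta c α ε ((firstIndex α ε : ℤ) - ((i : ℕ) : ℤ))

end ContFracErgodic

end

/-!
The distances satisfy `d_{n+1} = d_n · T^n α`, so `d_n = α · T α ⋯ T^(n-1) α` for irrational `α`
(`dist_eq_orbitProd`). The index `N(α, ε)` equals `n + 1` exactly for `d_{n+1} ≤ ε < d_n`, and since
`dε / ε` is invariant under scaling, the part of the integral over this range is, for `n ≥ m`, a
fixed function `F` (`blockIntegral`) evaluated at `T^(n-m) α` (`integral_integrand_block`). Hence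
the integral down to `d_n` is a Birkhoff sum of `F` up to a bounded term, while
`log (1 / d_n)` is the Birkhoff sum of `-log`. As `|F| ≤ C · |log ∘ T^m|`, both functions are
integrable for the Gauss measure `μ`, and the pointwise ergodic theorem gives the limit
`L = ∫ F dμ / ∫ -log dμ`; the incomplete last block is negligible because `log T^n α = o(n)`
(`tendsto_logAverage`). With the sign `(-1)^N` the Birkhoff sums of `F` become alternating;
grouping consecutive terms in pairs turns them into Birkhoff sums of `F - F ∘ T` along `T²`, which
have mean zero, so they are `o(n)` because `T²` is ergodic
(`ae_tendsto_alternating_birkhoffSum_div`).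

The pointwise ergodic theorem (`ae_tendsto_birkhoffSum_div`) is derived, in the ergodic case, from
the recursion for running maxima of Birkhoff sums. Ergodicity of all iterates of the Gauss map
(`ergodic_iterate_gaussMap`) comes from the bounded distortion of its inverse branches
`t ↦ (p_{n+1} + p_n t) / (q_{n+1} + q_n t)`: a `T^k`-invariant set `A` fills at least the proportion
`|A ∩ (0, 1)| / 8` of arbitrarily small balls around every irrational point, so by Lebesgue's
density theorem almost every point lies in `A` unless `A` is null.
-/

/-! ### The pointwise ergodic theorem -/

/-- The running maximum of the Birkhoff sums `S_1 φ, …, S_{n+1} φ`, defined through the recursion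
`max (S_1, …, S_{n+2}) = φ + max (0, max (S_1, …, S_{n+1}) ∘ T)`. -/
def birkhoffSumMax {Ω : Type*} (T : Ω → Ω) (φ : Ω → ℝ) : ℕ → Ω → ℝ
  | 0 => φ
  | n + 1 => fun x => φ x + max 0 (birkhoffSumMax T φ n (T x))

section Birkhoff

variable {Ω : Type*} {T : Ω → Ω} {φ : Ω → ℝ}

lemma birkhoffSumMax_le_succ (n : ℕ) (x : Ω) :
    birkhoffSumMax T φ n x ≤ birkhoffSumMax T φ (n + 1) x := by
  induction n generalizing x with
  | zero => simp [birkhoffSumMax]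
  | succ n ih =>
    exact add_le_add le_rfl (max_le_max le_rfl (ih (T x)))

lemma monotone_birkhoffSumMax (x : Ω) : Monotone (fun n => birkhoffSumMax T φ n x) :=
  monotone_nat_of_le_succ fun n => birkhoffSumMax_le_succ n x

lemma birkhoffSum_le_birkhoffSumMax (n : ℕ) (x : Ω) :
    birkhoffSum T φ (n + 1) x ≤ birkhoffSumMax T φ n x := by
  induction n generalizing x with
  | zero => simp [birkhoffSumMax]
  | succ n ih =>
    rw [birkhoffSum_succ']
    exact add_le_add le_rfl ((ih _).trans (le_max_right _ _))

variable [MeasurableSpace Ω] {μ : Measure Ω}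

lemma integrable_birkhoffSumMax (hT : MeasurePreserving T μ μ) (hφ : Integrable φ μ) (n : ℕ) :
    Integrable (birkhoffSumMax T φ n) μ := by
  induction n with
  | zero => exact hφ
  | succ n ih =>
    have h : Integrable (fun x => birkhoffSumMax T φ n (T x)) μ := hT.integrable_comp_of_integrable ih
    exact hφ.add ((integrable_zero _ _ _).sup h)

/-- If `∫ φ < 0`, ergodicity keeps the Birkhoff sums of `φ` bounded above almost everywhere. The
set where they are unbounded is invariant; were it of full measure, `Φ_{n+1} - Φ_n ∘ T`, with
`Φ_n` the running maxima, would decrease to `φ` almost everywhere, while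
`∫ (Φ_{n+1} - Φ_n ∘ T) = ∫ (Φ_{n+1} - Φ_n) ≥ 0`. -/
lemma ae_birkhoffSum_bddAbove (hT : Ergodic T μ) (hm : Measurable φ) (hφ : Integrable φ μ)
    (hneg : ∫ x, φ x ∂μ < 0) :
    ∀ᵐ x ∂μ, ∃ C : ℝ, ∀ n, birkhoffSum T φ n x ≤ C := by
  set A : Set Ω := {x | ∃ C : ℕ, ∀ n, birkhoffSum T φ n x ≤ C} with hA
  have hSm : ∀ n, Measurable (birkhoffSum T φ n) := fun n => by
    unfold birkhoffSum
    exact Finset.measurable_sum _ fun i _ => hm.comp (hT.measurable.iterate i)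
  have hAm : MeasurableSet A := by
    have : A = ⋃ C : ℕ, ⋂ n, {x | birkhoffSum T φ n x ≤ C} := by ext; simp [hA]
    rw [this]
    exact MeasurableSet.iUnion fun C => MeasurableSet.iInter fun n =>
      measurableSet_le (hSm n) measurable_const
  have hAinv : T ⁻¹' A = A := by
    ext x
    simp only [hA, mem_preimage, mem_ofPred_eq]
    constructor
    · rintro ⟨C, hC⟩
      obtain ⟨D, hD⟩ := exists_nat_ge (C + |φ x|)
      refine ⟨D, fun n => ?_⟩
      cases n with
      | zero => simp
      | succ n => rw [birkhoffSum_succ']; linarith [hC n, le_abs_self (φ x)]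
    · rintro ⟨C, hC⟩
      obtain ⟨D, hD⟩ := exists_nat_ge (C + |φ x|)
      refine ⟨D, fun n => ?_⟩
      have := hC (n + 1)
      rw [birkhoffSum_succ'] at this
      linarith [neg_abs_le (φ x)]
  rcases hT.ae_mem_or_ae_notMem hAm hAinv with h | h
  · filter_upwards [h] with x ⟨C, hC⟩ using ⟨C, hC⟩
  exfalso
  set Φ := birkhoffSumMax T φ with hΦ
  have hΦi : ∀ n, Integrable (Φ n) μ := integrable_birkhoffSumMax hT.toMeasurePreserving hφ
  have hΦTi : ∀ n, Integrable (fun x => Φ n (T x)) μ := fun n =>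
    hT.toMeasurePreserving.integrable_comp_of_integrable (hΦi n)
  have hΦT : ∀ n, ∫ x, Φ n (T x) ∂μ = ∫ x, Φ n x ∂μ := fun n => by
    have h1 := integral_map (μ := μ) (φ := T) hT.measurable.aemeasurable (f := Φ n)
      (by rw [hT.map_eq]; exact (hΦi n).aestronglyMeasurable)
    rw [hT.map_eq] at h1
    exact h1.symm
  have hnonneg : ∀ n, 0 ≤ ∫ x, (Φ (n + 1) x - Φ n (T x)) ∂μ := fun n => by
    rw [integral_sub (hΦi _) (hΦTi _), hΦT, sub_nonneg]
    exact integral_mono (hΦi _) (hΦi _) fun x => birkhoffSumMax_le_succ n x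
  have hlim : Tendsto (fun n => ∫ x, (Φ (n + 1) x - Φ n (T x)) ∂μ) atTop (𝓝 (∫ x, φ x ∂μ)) := by
    refine tendsto_integral_of_dominated_convergence (fun x => |φ x| + |Φ 0 (T x)|)
      (fun n => ((hΦi _).sub (hΦTi _)).aestronglyMeasurable) (hφ.abs.add (hΦTi 0).abs) ?_ ?_
    · refine fun n => Eventually.of_forall fun x => ?_
      have h0 : Φ 0 (T x) ≤ Φ n (T x) := monotone_birkhoffSumMax (T x) (Nat.zero_le n)
      have h1 : Φ (n + 1) x - Φ n (T x) = φ x + (max 0 (Φ n (T x)) - Φ n (T x)) := by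
        simp only [hΦ, birkhoffSumMax]; ring
      rw [h1, Real.norm_eq_abs]
      refine (abs_add_le _ _).trans (add_le_add le_rfl ?_)
      rcases le_total 0 (Φ n (T x)) with h2 | h2
      · rw [max_eq_right h2]; simp
      · rw [max_eq_left h2, zero_sub, abs_neg, abs_of_nonpos h2, abs_of_nonpos (h0.trans h2)]
        linarith
    · filter_upwards [h] with x hx
      refine tendsto_const_nhds.congr' ?_
      have hTx : T x ∉ A := fun hh => hx (by rw [← hAinv]; exact hh)
      simp only [hA, mem_ofPred_eq, not_exists, not_forall, not_le] at hTx
      obtain ⟨n, hn⟩ := hTx 0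
      cases n with
      | zero => simp at hn
      | succ k =>
        filter_upwards [eventually_ge_atTop k] with j hj
        have h3 : 0 ≤ Φ j (T x) :=
          ((by simpa using hn.le : 0 ≤ birkhoffSum T φ (k + 1) (T x)).trans
            (birkhoffSum_le_birkhoffSumMax k (T x))).trans (monotone_birkhoffSumMax (T x) hj)
        simp only [hΦ, birkhoffSumMax] at h3 ⊢
        rw [max_eq_right h3]; ring
  exact absurd (ge_of_tendsto' hlim hnonneg) (not_le.2 hneg)

/-- Upper half of the pointwise ergodic theorem. -/
lemma ae_birkhoffSum_le [IsProbabilityMeasure μ] (hT : Ergodic T μ) (hm : Measurable φ)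
    (hφ : Integrable φ μ) {ε : ℝ} (hε : 0 < ε) :
    ∀ᵐ x ∂μ, ∀ᶠ n : ℕ in atTop, birkhoffSum T φ n x ≤ n * (∫ y, φ y ∂μ + ε) := by
  have h := ae_birkhoffSum_bddAbove (φ := fun x => φ x - (∫ y, φ y ∂μ + ε / 2)) hT
    (hm.sub_const _) (hφ.sub (integrable_const _)) (by
      rw [integral_sub hφ (integrable_const _)]; simp; linarith)
  filter_upwards [h] with x ⟨C, hC⟩
  obtain ⟨N, hN⟩ := exists_nat_ge (C / (ε / 2))
  filter_upwards [eventually_ge_atTop N] with n hn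
  have h1 := hC n
  simp only [birkhoffSum, Finset.sum_sub_distrib, Finset.sum_const, Finset.card_range,
    nsmul_eq_mul] at h1 ⊢
  rw [div_le_iff₀ (by positivity)] at hN
  have : (N : ℝ) ≤ n := by exact_mod_cast hn
  nlinarith

/-- Birkhoff's pointwise ergodic theorem for an ergodic transformation. -/
theorem ae_tendsto_birkhoffSum_div [IsProbabilityMeasure μ] (hT : Ergodic T μ)
    (hm : Measurable φ) (hφ : Integrable φ μ) :
    ∀ᵐ x ∂μ, Tendsto (fun n : ℕ => birkhoffSum T φ n x / n) atTop (𝓝 (∫ y, φ y ∂μ)) := by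
  have h1 : ∀ᵐ x ∂μ, ∀ k : ℕ, ∀ᶠ n : ℕ in atTop,
      birkhoffSum T φ n x ≤ n * (∫ y, φ y ∂μ + 1 / ((k : ℝ) + 1)) :=
    ae_all_iff.2 fun k => ae_birkhoffSum_le hT hm hφ (by positivity)
  have h2 : ∀ᵐ x ∂μ, ∀ k : ℕ, ∀ᶠ n : ℕ in atTop,
      birkhoffSum T (fun y => - φ y) n x ≤ n * (∫ y, - φ y ∂μ + 1 / ((k : ℝ) + 1)) :=
    ae_all_iff.2 fun k => ae_birkhoffSum_le hT hm.neg hφ.neg (by positivity)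
  filter_upwards [h1, h2] with x h1 h2
  rw [Metric.tendsto_nhds]
  intro ε hε
  obtain ⟨k, hk⟩ := exists_nat_one_div_lt hε
  filter_upwards [h1 k, h2 k, eventually_gt_atTop 0] with n hn1 hn2 hn
  have hn' : (0 : ℝ) < n := by exact_mod_cast hn
  simp only [birkhoffSum, Finset.sum_neg_distrib, integral_neg] at hn2
  have hn2' : (n : ℝ) * (∫ y, φ y ∂μ - 1 / ((k : ℝ) + 1)) ≤ birkhoffSum T φ n x := by
    unfold birkhoffSum; nlinarith
  rw [Real.dist_eq, abs_lt]
  constructor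
  · have : ∫ y, φ y ∂μ - 1 / ((k : ℝ) + 1) ≤ birkhoffSum T φ n x / n := by
      rw [le_div_iff₀ hn']; linarith
    linarith
  · have : birkhoffSum T φ n x / n ≤ ∫ y, φ y ∂μ + 1 / ((k : ℝ) + 1) := by
      rw [div_le_iff₀ hn']; linarith
    linarith

/-- A sequence with convergent Cesàro means grows sublinearly. -/
lemma tendsto_div_of_tendsto_sum_div {u : ℕ → ℝ} {l : ℝ}
    (h : Tendsto (fun n : ℕ => (∑ i ∈ Finset.range n, u i) / n) atTop (𝓝 l)) :
    Tendsto (fun n : ℕ => u n / ((n + 1 : ℕ) : ℝ)) atTop (𝓝 0) := by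
  have h1 := h.comp (tendsto_add_atTop_nat 1)
  have h2 : Tendsto (fun n : ℕ => ((n : ℝ) / (n + 1 : ℕ))) atTop (𝓝 1) := by
    simpa using tendsto_natCast_div_add_atTop (1 : ℝ)
  have h3 := h1.sub (h.mul h2)
  rw [mul_one, sub_self] at h3
  refine h3.congr' ?_
  filter_upwards [eventually_gt_atTop 0] with n hn
  have : (n : ℝ) ≠ 0 := by exact_mod_cast hn.ne'
  have : (n : ℝ) + 1 ≠ 0 := by positivity
  simp only [Function.comp, Finset.sum_range_succ]
  push_cast
  field_simp
  ring

/-- If `T ∘ T` is ergodic, alternating Birkhoff averages vanish in the limit: grouped in pairs,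
they are the Birkhoff averages of `φ - φ ∘ T` along `T ∘ T`. -/
theorem ae_tendsto_alternating_birkhoffSum_div [IsProbabilityMeasure μ]
    (hT : MeasurePreserving T μ μ) (hT2 : Ergodic T^[2] μ) (hm : Measurable φ)
    (hφ : Integrable φ μ) :
    ∀ᵐ x ∂μ, Tendsto (fun n : ℕ => (∑ i ∈ Finset.range n, (-1 : ℝ) ^ i * φ (T^[i] x)) / n)
      atTop (𝓝 0) := by
  have hT1 : Ergodic T μ := ⟨hT, PreErgodic.of_iterate 2 hT2.toPreErgodic⟩
  have hφT : Integrable (fun x => φ (T x)) μ := hT.integrable_comp_of_integrable hφ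
  have hint : ∫ x, (φ x - φ (T x)) ∂μ = 0 := by
    have h1 := integral_map (μ := μ) (φ := T) hT.measurable.aemeasurable (f := φ)
      (by rw [hT.map_eq]; exact hφ.aestronglyMeasurable)
    rw [hT.map_eq] at h1
    rw [integral_sub hφ hφT, h1, sub_self]
  have h1 := ae_tendsto_birkhoffSum_div hT1 hm hφ
  have h2 := ae_tendsto_birkhoffSum_div hT2 (hm.sub (hm.comp hT.measurable)) (hφ.sub hφT)
  filter_upwards [h1, h2] with x h1 h2
  have h3 := tendsto_div_of_tendsto_sum_div h1
  replace h2 : Tendsto (fun n : ℕ => birkhoffSum T^[2] (fun x => φ x - φ (T x)) n x / n)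
      atTop (𝓝 0) := by
    rw [← hint]; exact h2
  set E : ℕ → ℝ := fun n => birkhoffSum T^[2] (fun x => φ x - φ (T x)) n x with hE
  set S : ℕ → ℝ := fun n => ∑ i ∈ Finset.range n, (-1 : ℝ) ^ i * φ (T^[i] x) with hS
  have hSE : ∀ k, S (2 * k) = E k := fun k => by
    induction k with
    | zero => simp [hS, hE]
    | succ k ih =>
      have e1 : S (2 * (k + 1)) = S (2 * k) + (φ (T^[2 * k] x) - φ (T (T^[2 * k] x))) := by
        simp only [hS]
        rw [show 2 * (k + 1) = 2 * k + 1 + 1 by ring, Finset.sum_range_succ,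
          Finset.sum_range_succ, Function.iterate_succ_apply', pow_succ, pow_mul]
        simp
        ring
      have e2 : E (k + 1) = E k + (φ (T^[2 * k] x) - φ (T (T^[2 * k] x))) := by
        simp only [hE]
        rw [birkhoffSum_succ, ← Function.iterate_mul]
      rw [e1, e2, ih]
  have key : ∀ n : ℕ, |S (n + 1)| ≤ |E ((n + 1) / 2)| + |φ (T^[n] x)| := fun n => by
    rcases Nat.even_or_odd' n with ⟨k, rfl | rfl⟩
    · have e1 : S (2 * k + 1) = E k + φ (T^[2 * k] x) := by
        rw [← hSE]; simp only [hS]; rw [Finset.sum_range_succ, pow_mul]; simp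
      rw [e1, show (2 * k + 1) / 2 = k by omega]
      exact abs_add_le _ _
    · rw [show 2 * k + 1 + 1 = 2 * (k + 1) by ring, hSE, show 2 * (k + 1) / 2 = k + 1 by omega]
      exact le_add_of_nonneg_right (abs_nonneg _)
  rw [← tendsto_add_atTop_iff_nat 1]
  have h4 : Tendsto (fun n : ℕ => |E ((n + 1) / 2) / (((n + 1) / 2 : ℕ) : ℝ)|) atTop (𝓝 0) := by
    have : Tendsto (fun n : ℕ => (n + 1) / 2) atTop atTop :=
      tendsto_atTop.2 fun b => by
        filter_upwards [eventually_ge_atTop (2 * b)] with n hn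
        omega
    have h := (h2.comp this).abs
    rw [abs_zero] at h
    exact h
  have h5 : Tendsto (fun n : ℕ => |φ (T^[n] x) / ((n + 1 : ℕ) : ℝ)|) atTop (𝓝 0) := by
    have h := h3.abs
    rw [abs_zero] at h
    exact h
  refine squeeze_zero_norm (fun n => ?_) (by have h := h4.add h5; rwa [add_zero] at h)
  simp only [Real.norm_eq_abs, abs_div, Nat.abs_cast]
  refine (div_le_div_of_nonneg_right (key n) (by positivity)).trans ?_
  rw [add_div]
  gcongr ?_ + _
  rcases Nat.eq_zero_or_pos ((n + 1) / 2) with h0 | h0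
  · rw [h0]; simp [hE]
  · have : (0 : ℝ) < (((n + 1) / 2 : ℕ) : ℝ) := by exact_mod_cast h0
    gcongr
    omega

end Birkhoff

namespace ContFracErgodic

/-! ### The Gauss map on the irrationals of the unit interval -/

/-- The irrational points of `(0, 1)`, a set of full measure which the Gauss map sends to itself. -/
def unitIrrationals : Set ℝ := {x | x ∈ Ioo (0 : ℝ) 1 ∧ Irrational x}

lemma ae_irrational : ∀ᵐ x : ℝ, Irrational x :=
  (countable_range ((↑) : ℚ → ℝ)).ae_notMem volume

lemma measurableSet_unitIrrationals : MeasurableSet unitIrrationals :=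
  measurableSet_Ioo.inter (countable_range ((↑) : ℚ → ℝ)).measurableSet.compl

lemma unitIrrationals_ae_eq : unitIrrationals =ᵐ[volume] Ioo (0 : ℝ) 1 := by
  filter_upwards [ae_irrational] with x hx
  exact propext ⟨fun h => h.1, fun h => ⟨h, hx⟩⟩

lemma measurable_gaussMap : Measurable gaussMap := by
  unfold gaussMap
  have h : Measurable fun x : ℝ => 1 / x := measurable_const.div measurable_id
  exact h.sub ((measurable_from_top (f := fun n : ℤ => (n : ℝ))).comp
    (Int.measurable_floor.comp h))

lemma gaussMap_mem {x : ℝ} (hx : x ∈ unitIrrationals) : gaussMap x ∈ unitIrrationals := by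
  have hirr : Irrational (gaussMap x) := by
    unfold gaussMap
    rw [one_div]
    exact (irrational_inv_iff.2 hx.2).sub_intCast _
  have h0 : gaussMap x = Int.fract (1 / x) := rfl
  refine ⟨⟨lt_of_le_of_ne (h0 ▸ Int.fract_nonneg _) hirr.ne_zero.symm, h0 ▸ Int.fract_lt_one _⟩,
    hirr⟩

lemma iterate_gaussMap_mem {x : ℝ} (hx : x ∈ unitIrrationals) (n : ℕ) :
    gaussMap^[n] x ∈ unitIrrationals := by
  induction n with
  | zero => exact hx
  | succ n ih => rw [Function.iterate_succ_apply']; exact gaussMap_mem ih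

lemma one_le_floor_one_div {x : ℝ} (hx : x ∈ unitIrrationals) : 1 ≤ ⌊1 / x⌋ := by
  rw [Int.le_floor, Int.cast_one]
  exact one_le_one_div hx.1.1 hx.1.2.le

lemma branch_mem {a : ℤ} (ha : 1 ≤ a) {t : ℝ} (ht : t ∈ unitIrrationals) :
    1 / (a + t) ∈ unitIrrationals := by
  have ha' : (1 : ℝ) ≤ a := by exact_mod_cast ha
  have h1 : 1 < a + t := by linarith [ht.1.1]
  refine ⟨⟨by positivity, by rw [div_lt_one (by linarith)]; exact h1⟩, ?_⟩
  rw [one_div]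
  exact irrational_inv_iff.2 (ht.2.intCast_add a)

lemma floor_one_div_branch {a : ℤ} {t : ℝ} (ht : t ∈ unitIrrationals) :
    ⌊1 / (1 / (a + t))⌋ = a := by
  rw [one_div_one_div, Int.floor_intCast_add, Int.floor_eq_zero_iff.2 ⟨ht.1.1.le, ht.1.2⟩, add_zero]

lemma gaussMap_branch {a : ℤ} {t : ℝ} (ht : t ∈ unitIrrationals) :
    gaussMap (1 / (a + t)) = t := by
  unfold gaussMap
  rw [floor_one_div_branch ht, one_div_one_div]
  ring

lemma one_div_floor_add_gaussMap (x : ℝ) : 1 / (⌊1 / x⌋ + gaussMap x) = x := by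
  unfold gaussMap
  rw [add_sub_cancel, one_div_one_div]

/-! ### Convergents -/

lemma partialQuot_succ (x : ℝ) (n : ℕ) : partialQuot x (n + 1) = ⌊1 / gaussMap^[n] x⌋ := rfl

lemma one_le_partialQuot {x : ℝ} (hx : x ∈ unitIrrationals) (n : ℕ) :
    1 ≤ partialQuot x (n + 1) :=
  one_le_floor_one_div (iterate_gaussMap_mem hx n)

lemma num_succ_succ (x : ℝ) (n : ℕ) :
    num x (n + 2) = partialQuot x (n + 1) * num x (n + 1) + num x n := rfl

lemma den_succ_succ (x : ℝ) (n : ℕ) :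
    den x (n + 2) = partialQuot x (n + 1) * den x (n + 1) + den x n := rfl

lemma one_le_den {x : ℝ} (hx : x ∈ unitIrrationals) (n : ℕ) :
    0 ≤ den x n ∧ 1 ≤ den x (n + 1) := by
  induction n with
  | zero => simp [den]
  | succ n ih =>
    have ha := one_le_partialQuot hx n
    exact ⟨by linarith, by rw [den_succ_succ]; nlinarith⟩

lemma den_succ_add_den_le {x : ℝ} (hx : x ∈ unitIrrationals) (n : ℕ) :
    den x (n + 1) + den x n ≤ den x (n + 2) := by
  rw [den_succ_succ]
  nlinarith [one_le_partialQuot hx n, one_le_den hx n]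

lemma den_le_den_succ {x : ℝ} (hx : x ∈ unitIrrationals) (n : ℕ) : den x n ≤ den x (n + 1) := by
  cases n with
  | zero => simp [den]
  | succ n => linarith [den_succ_add_den_le hx n, (one_le_den hx n).1]

lemma natCast_le_den_succ {x : ℝ} (hx : x ∈ unitIrrationals) (n : ℕ) :
    (n : ℤ) ≤ den x (n + 1) := by
  induction n with
  | zero => simp [den]
  | succ n ih =>
    cases n with
    | zero => simpa using (one_le_den hx 1).2
    | succ n =>
      push_cast at ih ⊢
      linarith [den_succ_add_den_le hx (n + 1), (one_le_den hx n).2]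

lemma num_mul_den_sub (x : ℝ) (n : ℕ) :
    num x n * den x (n + 1) - num x (n + 1) * den x n = (-1) ^ n := by
  induction n with
  | zero => simp [num, den]
  | succ n ih =>
    rw [num_succ_succ, den_succ_succ, pow_succ, ← ih]
    ring

/-- The signed error `q_n x - p_n` is multiplied by `-T^n x` when `n` increases by one. -/
lemma den_mul_sub_num_succ {x : ℝ} (hx : x ∈ unitIrrationals) (n : ℕ) :
    (den x (n + 1) : ℝ) * x - num x (n + 1) = -gaussMap^[n] x * (den x n * x - num x n) := by
  induction n with
  | zero => simp [num, den]
  | succ n ih =>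
    have h1 := iterate_gaussMap_mem hx n
    have h2 : gaussMap^[n] x * (partialQuot x (n + 1) + gaussMap^[n + 1] x) = 1 := by
      rw [Function.iterate_succ_apply', partialQuot_succ]
      have h3 := one_div_floor_add_gaussMap (gaussMap^[n] x)
      have h4 : (⌊1 / gaussMap^[n] x⌋ + gaussMap (gaussMap^[n] x) : ℝ) ≠ 0 := by
        intro h; rw [h] at h3; simp at h3; exact h1.1.1.ne h3
      nth_rewrite 1 [← h3]
      field_simp
    rw [num_succ_succ, den_succ_succ]
    push_cast
    rw [show ((partialQuot x (n + 1) : ℝ) * den x (n + 1) + den x n) * x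
      - (partialQuot x (n + 1) * num x (n + 1) + num x n)
      = partialQuot x (n + 1) * (den x (n + 1) * x - num x (n + 1)) + (den x n * x - num x n) by
        ring, ih]
    linear_combination (-(den x n * x - num x n)) * h2

lemma dist_succ {x : ℝ} (hx : x ∈ unitIrrationals) (n : ℕ) :
    dist x (n + 1) = dist x n * gaussMap^[n] x := by
  unfold dist
  rw [den_mul_sub_num_succ hx, abs_mul, abs_neg, abs_of_pos (iterate_gaussMap_mem hx n).1.1,
    mul_comm]

/-- The inverse branch of `T^n` on the cylinder of rank `n` that contains `x`. -/
noncomputable def invBranch (x : ℝ) (n : ℕ) (t : ℝ) : ℝ :=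
  (num x (n + 1) + num x n * t) / (den x (n + 1) + den x n * t)

lemma invBranch_den_pos {x : ℝ} (hx : x ∈ unitIrrationals) (n : ℕ) {t : ℝ} (ht : 0 ≤ t) :
    (den x (n + 1) : ℝ) ≤ den x (n + 1) + den x n * t ∧
      (0 : ℝ) < den x (n + 1) + den x n * t := by
  obtain ⟨h0, h2⟩ := one_le_den hx n
  have h0' : (0 : ℝ) ≤ den x n := by exact_mod_cast h0
  have h2' : (1 : ℝ) ≤ den x (n + 1) := by exact_mod_cast h2
  have := mul_nonneg h0' ht
  constructor <;> linarith

lemma invBranch_iterate {x : ℝ} (hx : x ∈ unitIrrationals) (n : ℕ) :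
    invBranch x n (gaussMap^[n] x) = x := by
  have h := (invBranch_den_pos hx n (iterate_gaussMap_mem hx n).1.1.le).2
  unfold invBranch
  rw [div_eq_iff h.ne']
  linear_combination -(den_mul_sub_num_succ hx n)

lemma iterate_invBranch {x : ℝ} (hx : x ∈ unitIrrationals) (n : ℕ) {t : ℝ}
    (ht : t ∈ unitIrrationals) : gaussMap^[n] (invBranch x n t) = t := by
  induction n generalizing t with
  | zero => simp [invBranch, num, den]
  | succ n ih =>
    have ha := one_le_partialQuot hx n
    have ha' : (1 : ℝ) ≤ partialQuot x (n + 1) := by exact_mod_cast ha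
    have h1 : (partialQuot x (n + 1) : ℝ) + t ≠ 0 := by linarith [ht.1.1]
    have hb := branch_mem ha ht
    have h2 := (invBranch_den_pos hx n hb.1.1.le).2.ne'
    have h3 := (invBranch_den_pos hx (n + 1) ht.1.1.le).2.ne'
    have key : invBranch x (n + 1) t = invBranch x n (1 / (partialQuot x (n + 1) + t)) := by
      unfold invBranch
      rw [div_eq_div_iff h3 h2, num_succ_succ, den_succ_succ]
      push_cast
      field_simp
      ring
    rw [Function.iterate_succ_apply', key, ih hb, gaussMap_branch ht]

lemma invBranch_sub {x : ℝ} (hx : x ∈ unitIrrationals) (n : ℕ) {s t : ℝ} (hs : 0 ≤ s)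
    (ht : 0 ≤ t) : invBranch x n t - invBranch x n s =
      (-1) ^ n * (t - s) / ((den x (n + 1) + den x n * t) * (den x (n + 1) + den x n * s)) := by
  have h := num_mul_den_sub x n
  have h' : (num x n : ℝ) * den x (n + 1) - num x (n + 1) * den x n = (-1) ^ n := by exact_mod_cast h
  unfold invBranch
  rw [div_sub_div _ _ (invBranch_den_pos hx n ht).2.ne' (invBranch_den_pos hx n hs).2.ne', ← h']
  congr 1
  ring

lemma abs_invBranch_sub_le {x : ℝ} (hx : x ∈ unitIrrationals) (n : ℕ) {t : ℝ}
    (ht : t ∈ unitIrrationals) : |invBranch x n t - x| ≤ 1 / (den x (n + 1) : ℝ) ^ 2 := by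
  have hs := iterate_gaussMap_mem hx n
  have h1 := invBranch_sub hx n hs.1.1.le ht.1.1.le
  rw [invBranch_iterate hx] at h1
  obtain ⟨ht1, ht2⟩ := invBranch_den_pos hx n ht.1.1.le
  obtain ⟨hs1, hs2⟩ := invBranch_den_pos hx n hs.1.1.le
  have hq : (1 : ℝ) ≤ den x (n + 1) := by exact_mod_cast (one_le_den hx n).2
  rw [h1, abs_div, abs_mul, abs_pow, abs_neg, abs_one, one_pow, one_mul, abs_of_pos (mul_pos ht2 hs2)]
  have h2 : |t - gaussMap^[n] x| ≤ 1 := by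
    rw [abs_le]; constructor <;> linarith [hs.1.1, hs.1.2, ht.1.1, ht.1.2]
  have h3 : (den x (n + 1) : ℝ) ^ 2 ≤
      (den x (n + 1) + den x n * t) * (den x (n + 1) + den x n * gaussMap^[n] x) := by
    rw [sq]; exact mul_le_mul ht1 hs1 (by linarith) ht2.le
  exact div_le_div₀ zero_le_one h2 (by positivity) h3

lemma hasDerivAt_invBranch {x : ℝ} (hx : x ∈ unitIrrationals) (n : ℕ) {t : ℝ} (ht : 0 ≤ t) :
    HasDerivAt (invBranch x n) ((-1) ^ n / (den x (n + 1) + den x n * t) ^ 2) t := by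
  have h := num_mul_den_sub x n
  have h' : (num x n : ℝ) * den x (n + 1) - num x (n + 1) * den x n = (-1) ^ n := by exact_mod_cast h
  have h1 : HasDerivAt (fun t : ℝ => (num x (n + 1) : ℝ) + num x n * t) (num x n) t := by
    simpa using ((hasDerivAt_id t).const_mul (num x n : ℝ)).const_add (num x (n + 1) : ℝ)
  have h2 : HasDerivAt (fun t : ℝ => (den x (n + 1) : ℝ) + den x n * t) (den x n) t := by
    simpa using ((hasDerivAt_id t).const_mul (den x n : ℝ)).const_add (den x (n + 1) : ℝ)
  have h3 := h1.div h2 (invBranch_den_pos hx n ht).2.ne'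
  refine h3.congr_deriv ?_
  rw [← h']
  congr 1
  ring

/-! ### The Gauss measure is invariant -/

/-- The Gauss measure `dx / ((1 + x) log 2)` on `(0, 1)`, as a measure on `ℝ`. -/
noncomputable def gaussMeasure : Measure ℝ :=
  (volume.restrict (Ioo (0 : ℝ) 1)).withDensity
    fun x => ENNReal.ofReal (1 / (Real.log 2 * (1 + x)))

lemma measurable_gaussDensity :
    Measurable fun x : ℝ => ENNReal.ofReal (1 / (Real.log 2 * (1 + x))) := by
  fun_prop

lemma gaussMeasure_apply {B : Set ℝ} (hB : MeasurableSet B) :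
    gaussMeasure B = ∫⁻ x in B ∩ unitIrrationals, ENNReal.ofReal (1 / (Real.log 2 * (1 + x))) := by
  unfold gaussMeasure
  rw [withDensity_apply _ hB, Measure.restrict_restrict hB]
  exact setLIntegral_congr ((ae_eq_refl B).inter unitIrrationals_ae_eq.symm)

instance isProbabilityMeasure_gaussMeasure : IsProbabilityMeasure gaussMeasure := by
  constructor
  have hlog : 0 < Real.log 2 := Real.log_pos one_lt_two
  have hc : ContinuousOn (fun x : ℝ => 1 / (Real.log 2 * (1 + x))) (Icc 0 1) := by
    refine continuousOn_const.div (by fun_prop) fun x hx => ?_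
    have : 0 < 1 + x := by linarith [hx.1]
    positivity
  have hint : IntegrableOn (fun x : ℝ => 1 / (Real.log 2 * (1 + x))) (Ioo 0 1) :=
    (hc.integrableOn_compact isCompact_Icc).mono_set Ioo_subset_Icc_self
  unfold gaussMeasure
  rw [withDensity_apply _ MeasurableSet.univ, Measure.restrict_univ,
    ← ofReal_integral_eq_lintegral_ofReal hint, ← integral_Ioc_eq_integral_Ioo,
    ← intervalIntegral.integral_of_le zero_le_one,
    intervalIntegral.integral_eq_sub_of_hasDerivAt (f := fun x => Real.log (1 + x) / Real.log 2)]
  · rw [show (1 : ℝ) + 1 = 2 by norm_num]; simp [hlog.ne']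
  · intro x hx
    rw [uIcc_of_le zero_le_one] at hx
    have : 1 + x ≠ 0 := by linarith [hx.1]
    have h1 := (((hasDerivAt_id x).const_add 1).log this).div_const (Real.log 2)
    refine h1.congr_deriv ?_
    simp only [id]
    field_simp
  · exact ContinuousOn.intervalIntegrable (by rwa [uIcc_of_le zero_le_one])
  · filter_upwards [ae_restrict_mem measurableSet_Ioo] with x hx
    have : 0 < 1 + x := by linarith [hx.1]
    simp only [Pi.zero_apply]; positivity

lemma ae_volume_iff_ae_gaussMeasure {p : ℝ → Prop} :
    (∀ᵐ x ∂(volume.restrict (Ioo (0 : ℝ) 1)), p x) ↔ ∀ᵐ x ∂gaussMeasure, p x := by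
  constructor
  · exact fun h => (withDensity_absolutelyContinuous _ _).ae_le h
  · intro h
    refine (withDensity_absolutelyContinuous' measurable_gaussDensity.aemeasurable ?_).ae_le h
    filter_upwards [ae_restrict_mem measurableSet_Ioo] with x hx
    have : 0 < 1 + x := by linarith [hx.1]
    have hlog : 0 < Real.log 2 := Real.log_pos one_lt_two
    exact (ENNReal.ofReal_pos.2 (by positivity)).ne'

lemma ae_mem_unitIrrationals : ∀ᵐ x ∂gaussMeasure, x ∈ unitIrrationals := by
  rw [← ae_volume_iff_ae_gaussMeasure]
  filter_upwards [ae_restrict_mem measurableSet_Ioo, ae_restrict_of_ae ae_irrational] with x h1 h2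
  exact ⟨h1, h2⟩

lemma integrable_gaussMeasure_of_integrableOn {g : ℝ → ℝ} (hg : IntegrableOn g (Ioo 0 1)) :
    Integrable g gaussMeasure := by
  have h : gaussMeasure ≤ ENNReal.ofReal (1 / Real.log 2) • volume.restrict (Ioo (0 : ℝ) 1) := by
    rw [← withDensity_const]
    refine withDensity_mono ?_
    filter_upwards [ae_restrict_mem measurableSet_Ioo] with x hx
    have hlog : 0 < Real.log 2 := Real.log_pos one_lt_two
    refine ENNReal.ofReal_le_ofReal (one_div_le_one_div_of_le hlog ?_)
    nlinarith [hx.1]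
  exact Integrable.mono_measure (hg.smul_measure ENNReal.ofReal_ne_top) h

/-- The Gauss density is the sum of its transforms under the inverse branches of the Gauss map:
the series telescopes. -/
lemma tsum_gaussDensity_branch {t : ℝ} (ht : 0 < t) :
    ∑' a : ℕ, ENNReal.ofReal (|-1 / ((((a : ℤ) + 1 : ℤ) : ℝ) + t) ^ 2|) *
      ENNReal.ofReal (1 / (Real.log 2 * (1 + 1 / ((((a : ℤ) + 1 : ℤ) : ℝ) + t)))) =
      ENNReal.ofReal (1 / (Real.log 2 * (1 + t))) := by
  have hlog : 0 < Real.log 2 := Real.log_pos one_lt_two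
  set u : ℕ → ℝ := fun a => 1 / (Real.log 2 * (a + 1 + t)) with hu
  have hterm : ∀ a : ℕ, ENNReal.ofReal (|-1 / ((((a : ℤ) + 1 : ℤ) : ℝ) + t) ^ 2|) *
      ENNReal.ofReal (1 / (Real.log 2 * (1 + 1 / ((((a : ℤ) + 1 : ℤ) : ℝ) + t)))) =
      ENNReal.ofReal (u a - u (a + 1)) := fun a => by
    rw [← ENNReal.ofReal_mul (abs_nonneg _)]
    congr 1
    push_cast
    have h1 : (0 : ℝ) < a + 1 + t := by positivity
    have h2 : (0 : ℝ) < a + 1 + 1 + t := by positivity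
    rw [abs_div, abs_neg, abs_one, abs_of_pos (by positivity)]
    simp only [hu]
    push_cast
    have h3 : 1 + 1 / ((a : ℝ) + 1 + t) = (a + 1 + 1 + t) / (a + 1 + t) := by
      field_simp; ring
    rw [h3]
    field_simp
    ring
  have hnn : ∀ a, 0 ≤ u a - u (a + 1) := fun a => by
    simp only [hu, sub_nonneg]
    push_cast
    apply one_div_le_one_div_of_le (by positivity)
    nlinarith
  have hsum : HasSum (fun a => u a - u (a + 1)) (u 0) := by
    rw [hasSum_iff_tendsto_nat_of_nonneg hnn]
    have h : Tendsto u atTop (𝓝 0) := by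
      have h1 : Tendsto (fun a : ℕ => Real.log 2 * ((a : ℝ) + 1 + t)) atTop atTop := by
        refine Tendsto.const_mul_atTop hlog ?_
        exact tendsto_atTop_add_const_right _ _
          (tendsto_atTop_add_const_right _ _ tendsto_natCast_atTop_atTop)
      exact h1.inv_tendsto_atTop.congr fun a => by simp [hu]
    simp_rw [Finset.sum_range_sub']
    simpa using h.const_sub (u 0)
  rw [tsum_congr hterm, ← ENNReal.ofReal_tsum_of_nonneg hnn hsum.summable, hsum.tsum_eq]
  simp [hu]

theorem measurePreserving_gaussMap : MeasurePreserving gaussMap gaussMeasure gaussMeasure := by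
  refine ⟨measurable_gaussMap, Measure.ext fun A hA => ?_⟩
  rw [Measure.map_apply measurable_gaussMap hA, gaussMeasure_apply (measurable_gaussMap hA),
    gaussMeasure_apply hA]
  set φ : ℕ → ℝ → ℝ := fun a t => 1 / ((((a : ℤ) + 1 : ℤ) : ℝ) + t) with hφ
  have hAX : MeasurableSet (A ∩ unitIrrationals) := hA.inter measurableSet_unitIrrationals
  have hpos : ∀ a : ℕ, ∀ t ∈ A ∩ unitIrrationals, (0 : ℝ) < (((a : ℤ) + 1 : ℤ) : ℝ) + t :=
    fun a t ht => by push_cast; linarith [ht.2.1.1, (Nat.cast_nonneg a : (0 : ℝ) ≤ a)]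
  have hder : ∀ a : ℕ, ∀ t ∈ A ∩ unitIrrationals,
      HasDerivWithinAt (φ a) (-1 / ((((a : ℤ) + 1 : ℤ) : ℝ) + t) ^ 2) (A ∩ unitIrrationals) t :=
    fun a t ht => by
      have h := (((hasDerivAt_id t).const_add ((((a : ℤ) + 1 : ℤ) : ℝ))).inv
        (hpos a t ht).ne').hasDerivWithinAt (s := A ∩ unitIrrationals)
      simpa [hφ, one_div, Pi.inv_def] using h
  have hinj : ∀ a : ℕ, InjOn (φ a) (A ∩ unitIrrationals) := fun a s hs t ht h => by
    rw [← gaussMap_branch (a := (a : ℤ) + 1) hs.2, ← gaussMap_branch (a := (a : ℤ) + 1) ht.2]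
    exact congrArg gaussMap h
  have hunion : gaussMap ⁻¹' A ∩ unitIrrationals = ⋃ a : ℕ, φ a '' (A ∩ unitIrrationals) := by
    ext x
    simp only [mem_inter_iff, mem_preimage, mem_iUnion, mem_image]
    constructor
    · rintro ⟨hxA, hx⟩
      have h1 := one_le_floor_one_div hx
      refine ⟨(⌊1 / x⌋ - 1).toNat, gaussMap x, ⟨hxA, gaussMap_mem hx⟩, ?_⟩
      simp only [hφ]
      rw [Int.toNat_of_nonneg (by omega), sub_add_cancel]
      exact one_div_floor_add_gaussMap x
    · rintro ⟨a, t, ⟨htA, ht⟩, rfl⟩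
      exact ⟨by simp only [hφ]; rw [gaussMap_branch ht]; exact htA, branch_mem (by omega) ht⟩
  have hdisj : Pairwise (Function.onFun Disjoint fun a : ℕ => φ a '' (A ∩ unitIrrationals)) := by
    intro a b hab
    refine disjoint_left.2 ?_
    rintro x ⟨s, hs, rfl⟩ ⟨t, ht, h⟩
    have h1 : ⌊1 / φ b t⌋ = ⌊1 / φ a s⌋ := by rw [h]
    simp only [hφ] at h1
    rw [floor_one_div_branch ht.2, floor_one_div_branch hs.2] at h1
    omega
  have hmeas : ∀ a : ℕ, MeasurableSet (φ a '' (A ∩ unitIrrationals)) := fun a =>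
    hAX.image_of_continuousOn_injOn (fun t ht => (hder a t ht).continuousWithinAt) (hinj a)
  rw [hunion, lintegral_iUnion hmeas hdisj]
  simp_rw [fun a : ℕ => lintegral_image_eq_lintegral_abs_deriv_mul hAX (hder a) (hinj a)]
  rw [← lintegral_tsum fun a => by simp only [hφ]; fun_prop]
  refine setLIntegral_congr_fun hAX fun t ht => ?_
  exact tsum_gaussDensity_branch ht.2.1.1

/-! ### Ergodicity of the iterates of the Gauss map -/

/-- A set invariant under `T^k` occupies a definite proportion of every small ball around an
irrational point, because the inverse branches have bounded distortion:
`1 / (4 q²) ≤ |ψ'| ≤ 1 / q²` on a cylinder, which lies in the ball of radius `1 / q²`. -/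
lemma volume_div_eight_le {A : Set ℝ} (hA : MeasurableSet A) {n : ℕ}
    (hAn : gaussMap^[n] ⁻¹' A = A) {x : ℝ} (hx : x ∈ unitIrrationals) :
    volume (A ∩ unitIrrationals) / 8 ≤
      volume (A ∩ Metric.closedBall x (1 / (den x (n + 1) : ℝ) ^ 2)) /
        volume (Metric.closedBall x (1 / (den x (n + 1) : ℝ) ^ 2)) := by
  have hAX : MeasurableSet (A ∩ unitIrrationals) := hA.inter measurableSet_unitIrrationals
  obtain ⟨h0, h2⟩ := one_le_den hx n
  have h1 := den_le_den_succ hx n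
  have h0' : (0 : ℝ) ≤ den x n := by exact_mod_cast h0
  have h1' : (den x n : ℝ) ≤ den x (n + 1) := by exact_mod_cast h1
  have h2' : (1 : ℝ) ≤ den x (n + 1) := by exact_mod_cast h2
  set q : ℝ := (den x (n + 1) : ℝ) with hq
  have hsub : invBranch x n '' (A ∩ unitIrrationals) ⊆ A ∩ Metric.closedBall x (1 / q ^ 2) := by
    rintro _ ⟨t, ht, rfl⟩
    refine ⟨?_, ?_⟩
    · rw [← hAn, mem_preimage, iterate_invBranch hx n ht.2]; exact ht.1
    · rw [Metric.mem_closedBall, Real.dist_eq]; exact abs_invBranch_sub_le hx n ht.2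
  have hinj : InjOn (invBranch x n) (A ∩ unitIrrationals) := fun s hs t ht h => by
    rw [← iterate_invBranch hx n hs.2, ← iterate_invBranch hx n ht.2, h]
  have himg := lintegral_image_eq_lintegral_abs_deriv_mul hAX
    (fun t ht => (hasDerivAt_invBranch hx n ht.2.1.1.le).hasDerivWithinAt) hinj (fun _ => 1)
  have hlow : ENNReal.ofReal (1 / (4 * q ^ 2)) * volume (A ∩ unitIrrationals) ≤
      volume (invBranch x n '' (A ∩ unitIrrationals)) := by
    rw [setLIntegral_one] at himg
    rw [himg, ← setLIntegral_const]
    refine setLIntegral_mono' hAX fun t ht => ?_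
    rw [mul_one]
    refine ENNReal.ofReal_le_ofReal ?_
    have h3 := (invBranch_den_pos hx n ht.2.1.1.le).2
    rw [abs_div, abs_pow, abs_neg, abs_one, one_pow, abs_of_pos (pow_pos h3 2)]
    apply one_div_le_one_div_of_le (pow_pos h3 2)
    have h4 : (den x (n + 1) : ℝ) + den x n * t ≤ 2 * q := by
      have := mul_le_mul h1' ht.2.1.2.le ht.2.1.1.le (by linarith)
      linarith
    nlinarith
  have hr : 0 < 1 / q ^ 2 := by positivity
  rw [Real.volume_closedBall, ENNReal.le_div_iff_mul_le
    (Or.inl (ENNReal.ofReal_pos.2 (by linarith)).ne') (Or.inl ENNReal.ofReal_ne_top)]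
  refine le_trans (le_of_eq ?_) (hlow.trans (measure_mono hsub))
  rw [show (1 : ℝ) / (4 * q ^ 2) = 8⁻¹ * (2 * (1 / q ^ 2)) by field_simp; norm_num,
    ENNReal.div_eq_inv_mul, ENNReal.ofReal_mul (p := 8⁻¹) (by norm_num),
    ENNReal.ofReal_inv_of_pos (by norm_num), ENNReal.ofReal_ofNat]
  ring

/-- Every iterate of the Gauss map is ergodic: by the Lebesgue density theorem an invariant set of
positive measure contains almost every point. -/
theorem ergodic_iterate_gaussMap {k : ℕ} (hk : 0 < k) : Ergodic gaussMap^[k] gaussMeasure := by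
  refine ⟨measurePreserving_gaussMap.iterate k, ⟨fun A hA hinv => ?_⟩⟩
  rw [eventuallyConst_set]
  by_cases h0 : volume (A ∩ unitIrrationals) = 0
  · right
    rw [← ae_volume_iff_ae_gaussMeasure, ae_restrict_iff' measurableSet_Ioo]
    have h1 : ∀ᵐ x : ℝ, x ∉ A ∩ unitIrrationals := measure_eq_zero_iff_ae_notMem.1 h0
    filter_upwards [h1, ae_irrational] with x hx hirr hx01 hxA
    exact hx ⟨hxA, hx01, hirr⟩
  · left
    rw [← ae_volume_iff_ae_gaussMeasure, ae_restrict_iff' measurableSet_Ioo]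
    filter_upwards [Besicovitch.ae_tendsto_measure_inter_div_of_measurableSet volume hA,
      ae_irrational] with x hx hirr hx01
    by_contra hxA
    have hxX : x ∈ unitIrrationals := ⟨hx01, hirr⟩
    rw [indicator_of_notMem hxA] at hx
    have hr : Tendsto (fun j : ℕ => 1 / (den x (k * j + 1) : ℝ) ^ 2) atTop (𝓝[>] 0) := by
      refine tendsto_nhdsWithin_iff.2 ⟨?_, Eventually.of_forall fun j => ?_⟩
      · have hle : ∀ j : ℕ, (j : ℝ) ≤ (den x (k * j + 1) : ℝ) ^ 2 := fun j => by
          have h2 : (1 : ℝ) ≤ den x (k * j + 1) := by exact_mod_cast (one_le_den hxX (k * j)).2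
          have h3 : ((k * j : ℕ) : ℝ) ≤ den x (k * j + 1) := by
            exact_mod_cast natCast_le_den_succ hxX (k * j)
          have h4 : (j : ℝ) ≤ (k * j : ℕ) := by exact_mod_cast Nat.le_mul_of_pos_left j hk
          nlinarith
        exact (tendsto_atTop_mono hle tendsto_natCast_atTop_atTop).inv_tendsto_atTop.congr
          fun j => by simp
      · have h2 : (1 : ℝ) ≤ den x (k * j + 1) := by exact_mod_cast (one_le_den hxX (k * j)).2
        exact mem_Ioi.2 (by positivity)
    have h2 := ge_of_tendsto' (hx.comp hr) fun j => volume_div_eight_le hA (n := k * j)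
      (by rw [Function.iterate_mul]; exact Function.IsFixedPt.preimage_iterate hinv j) hxX
    simp at h2
    exact h0 h2

/-! ### Integrals over one block of scales -/

/-- The product `x · T x ⋯ T^(k-1) x` along the Gauss orbit. For irrational `x` in `(0, 1)` it
equals `d_k(x)`. -/
noncomputable def orbitProd (k : ℕ) (x : ℝ) : ℝ := ∏ j ∈ Finset.range k, gaussMap^[j] x

lemma orbitProd_succ (k : ℕ) (x : ℝ) : orbitProd (k + 1) x = orbitProd k x * gaussMap^[k] x :=
  Finset.prod_range_succ _ _

lemma orbitProd_add (j k : ℕ) (x : ℝ) :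
    orbitProd (j + k) x = orbitProd j x * orbitProd k (gaussMap^[j] x) := by
  unfold orbitProd
  rw [Finset.prod_range_add]
  congr 1
  refine Finset.prod_congr rfl fun i _ => ?_
  rw [add_comm j i, Function.iterate_add_apply]

lemma dist_eq_orbitProd {x : ℝ} (hx : x ∈ unitIrrationals) (n : ℕ) :
    dist x n = orbitProd n x := by
  induction n with
  | zero => simp [dist, num, den, orbitProd]
  | succ n ih => rw [dist_succ hx, ih, orbitProd_succ]

lemma orbitProd_pos {x : ℝ} (hx : x ∈ unitIrrationals) (n : ℕ) : 0 < orbitProd n x :=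
  Finset.prod_pos fun j _ => (iterate_gaussMap_mem hx j).1.1

lemma measurable_orbitProd (k : ℕ) : Measurable (orbitProd k) := by
  unfold orbitProd
  exact Finset.measurable_prod _ fun j _ => measurable_gaussMap.iterate j

lemma log_orbitProd {x : ℝ} (hx : x ∈ unitIrrationals) (n : ℕ) :
    -Real.log (orbitProd n x) = birkhoffSum gaussMap (fun y => -Real.log y) n x := by
  unfold orbitProd birkhoffSum
  rw [Real.log_prod fun j _ => (iterate_gaussMap_mem hx j).1.1.ne', Finset.sum_neg_distrib]

lemma dist_pos {x : ℝ} (hx : x ∈ unitIrrationals) (n : ℕ) : 0 < dist x n := by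
  rw [dist_eq_orbitProd hx]; exact orbitProd_pos hx n

lemma dist_strictAnti {x : ℝ} (hx : x ∈ unitIrrationals) : StrictAnti (dist x) :=
  strictAnti_nat_of_succ_lt fun n => by
    rw [dist_succ hx]
    exact mul_lt_of_lt_one_right (dist_pos hx n) (iterate_gaussMap_mem hx n).1.2

lemma abs_intervalIntegral_le_log {h : ℝ → ℝ} {a b C : ℝ} (ha : 0 < a) (hab : a ≤ b)
    (hh : ∀ s ∈ Ioc a b, |h s| ≤ C / s) :
    |∫ s in a..b, h s| ≤ C * (Real.log b - Real.log a) := by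
  have hb : 0 < b := ha.trans_le hab
  have hint : IntervalIntegrable (fun s : ℝ => C / s) volume a b := by
    refine ContinuousOn.intervalIntegrable (continuousOn_const.div continuousOn_id fun s hs => ?_)
    rw [uIcc_of_le hab] at hs
    exact (ha.trans_le hs.1).ne'
  have h1 := intervalIntegral.norm_integral_le_of_norm_le (f := h) hab
    (Eventually.of_forall fun s hs => hh s hs) hint
  refine h1.trans (le_of_eq ?_)
  simp_rw [div_eq_mul_inv]
  rw [intervalIntegral.integral_const_mul, integral_inv_of_pos ha hb,
    Real.log_div hb.ne' ha.ne']

/-- The contribution to the logarithmic integral of the scales `ε` between two consecutive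
distances, `d_{m+1} ≤ ε < d_m`, as a function of the point: it is invariant under scaling, so for
any later pair of distances it is the same function at an iterate of the Gauss map. -/
noncomputable def blockIntegral (m : ℕ) (f : (Fin (m + 1) → ℝ) → ℝ) (x : ℝ) : ℝ :=
  ∫ s in Ioc (orbitProd (m + 1) x) (orbitProd m x),
    f (fun i => orbitProd (m + 1 - i) x / s) / s

variable {m : ℕ} {f : (Fin (m + 1) → ℝ) → ℝ} {C : ℝ}

lemma measurable_blockIntegral (hf : Measurable f) : Measurable (blockIntegral m f) := by
  set S : Set (ℝ × ℝ) := {p | orbitProd (m + 1) p.1 < p.2 ∧ p.2 ≤ orbitProd m p.1} with hS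
  have hSm : MeasurableSet S :=
    (measurableSet_lt ((measurable_orbitProd _).comp measurable_fst) measurable_snd).inter
      (measurableSet_le measurable_snd ((measurable_orbitProd _).comp measurable_fst))
  have hg : Measurable (S.indicator fun p : ℝ × ℝ =>
      f (fun i => orbitProd (m + 1 - i) p.1 / p.2) / p.2) := by
    refine Measurable.indicator ((hf.comp (measurable_pi_lambda _ fun i => ?_)).div
      measurable_snd) hSm
    exact ((measurable_orbitProd _).comp measurable_fst).div measurable_snd
  have h := (StronglyMeasurable.integral_prod_right' (ν := volume) hg.stronglyMeasurable).measurable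
  convert h using 2 with x
  unfold blockIntegral
  rw [← integral_indicator measurableSet_Ioc]
  rfl

lemma abs_blockIntegral_le (hC : ∀ v, |f v| ≤ C) {x : ℝ} (hx : x ∈ unitIrrationals) :
    |blockIntegral m f x| ≤ C * -Real.log (gaussMap^[m] x) := by
  have h0 := orbitProd_pos hx m
  have h1 := orbitProd_pos hx (m + 1)
  have h2 := iterate_gaussMap_mem hx m
  have h3 : orbitProd (m + 1) x ≤ orbitProd m x := by
    rw [orbitProd_succ]; exact mul_le_of_le_one_right h0.le h2.1.2.le
  unfold blockIntegral
  rw [← intervalIntegral.integral_of_le h3]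
  refine (abs_intervalIntegral_le_log (C := C) h1 h3 fun s hs => ?_).trans (le_of_eq ?_)
  · rw [abs_div, abs_of_pos (h1.trans hs.1)]
    exact div_le_div_of_nonneg_right (hC _) (h1.trans hs.1).le
  · rw [orbitProd_succ, Real.log_mul h0.ne' h2.1.1.ne']
    ring

lemma integrable_neg_log : Integrable (fun x => -Real.log x) gaussMeasure := by
  refine integrable_gaussMeasure_of_integrableOn (Integrable.neg ?_)
  have h : IntervalIntegrable Real.log volume 0 1 := intervalIntegral.intervalIntegrable_log'
  rw [intervalIntegrable_iff_integrableOn_Ioc_of_le zero_le_one] at h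
  exact h.mono_set Ioo_subset_Ioc_self

lemma integral_neg_log_pos : 0 < ∫ x, -Real.log x ∂gaussMeasure := by
  have h : ∀ᵐ x ∂gaussMeasure, 0 < -Real.log x := by
    filter_upwards [ae_mem_unitIrrationals] with x hx
    exact neg_pos.2 (Real.log_neg hx.1.1 hx.1.2)
  rw [integral_pos_iff_support_of_nonneg_ae (h.mono fun x hx => hx.le) integrable_neg_log]
  have h1 : gaussMeasure (Function.support fun x => -Real.log x)ᶜ = 0 :=
    measure_mono_null (fun x hx => by simpa using hx)
      (ae_iff.1 (h.mono fun x hx => (hx.ne' : -Real.log x ≠ 0)))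
  rw [measure_of_measure_compl_eq_zero h1]
  simp

lemma integrable_blockIntegral (hf : Measurable f) (hC : ∀ v, |f v| ≤ C) :
    Integrable (blockIntegral m f) gaussMeasure := by
  have h := ((measurePreserving_gaussMap.iterate m).integrable_comp_of_integrable
    integrable_neg_log).const_mul C
  refine h.mono' (measurable_blockIntegral hf).aestronglyMeasurable ?_
  filter_upwards [ae_mem_unitIrrationals] with x hx using abs_blockIntegral_le hC hx

/-! ### From Birkhoff averages to logarithmic averages -/

lemma measurable_firstIndex (α : ℝ) : Measurable (firstIndex α) := by
  classical
  -- the second alternative accounts for the value `0` of the infimum of the empty set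
  have hp : ∀ ε : ℝ, ∃ n, dist α n ≤ ε ∨ ∀ j, ¬ dist α j ≤ ε := fun ε => by
    by_cases h : ∃ n, dist α n ≤ ε
    · obtain ⟨n, hn⟩ := h; exact ⟨n, Or.inl hn⟩
    · exact ⟨0, Or.inr (not_exists.1 h)⟩
  have hm : ∀ n, MeasurableSet {ε : ℝ | dist α n ≤ ε ∨ ∀ j, ¬ dist α j ≤ ε} := fun n => by
    refine MeasurableSet.union measurableSet_Ici ?_
    have : {ε : ℝ | ∀ j, ¬ dist α j ≤ ε} = ⋂ j, (Ici (dist α j))ᶜ := by ext; simp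
    change MeasurableSet {ε : ℝ | ∀ j, ¬ dist α j ≤ ε}
    rw [this]
    exact MeasurableSet.iInter fun j => measurableSet_Ici.compl
  convert measurable_find hp hm using 2 with ε
  unfold firstIndex
  by_cases h : ∃ n, dist α n ≤ ε
  · have h1 : dist α (sInf {n | dist α n ≤ ε}) ≤ ε := Nat.sInf_mem (s := {n | dist α n ≤ ε}) h
    exact le_antisymm (Nat.sInf_le ((Nat.find_spec (hp ε)).resolve_right (not_forall_not.2 h)))
      (Nat.find_min' (hp ε) (Or.inl h1))
  · have he : {n : ℕ | dist α n ≤ ε} = ∅ := by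
      ext n; simpa using not_exists.1 h n
    rw [he, Nat.sInf_empty]
    exact ((Nat.find_eq_zero _).2 (Or.inr (not_exists.1 h))).symm

lemma measurable_integrand (hf : Measurable f) (σ : ℝ) (c : ℕ → ℝ) (α : ℝ) :
    Measurable fun ε => σ ^ firstIndex α ε * f (window m c α ε) / ε := by
  have h1 := measurable_firstIndex α
  have h2 : Measurable fun ε => window m c α ε := by
    refine measurable_pi_lambda _ fun i => Measurable.div ?_ measurable_id
    exact (measurable_from_top (f := fun n : ℕ => extDist c α ((n : ℤ) - ((i : ℕ) : ℤ)))).comp h1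
  exact (((measurable_from_top (f := fun n : ℕ => σ ^ n)).comp h1).mul (hf.comp h2)).div
    measurable_id

lemma abs_integrand_le (hC : ∀ v, |f v| ≤ C) {σ : ℝ} (hσ : |σ| = 1) (c : ℕ → ℝ) (α : ℝ) {ε : ℝ}
    (hε : 0 < ε) : |σ ^ firstIndex α ε * f (window m c α ε) / ε| ≤ C / ε := by
  rw [abs_div, abs_mul, abs_pow, hσ, one_pow, one_mul, abs_of_pos hε]
  exact div_le_div_of_nonneg_right (hC _) hε.le

lemma intervalIntegrable_integrand (hf : Measurable f) (hC : ∀ v, |f v| ≤ C) {σ : ℝ}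
    (hσ : |σ| = 1) (c : ℕ → ℝ) (α : ℝ) {a b : ℝ} (ha : 0 < a) (hb : 0 < b) :
    IntervalIntegrable (fun ε => σ ^ firstIndex α ε * f (window m c α ε) / ε) volume a b := by
  have hpos : ∀ s ∈ uIcc a b, 0 < s := fun s hs => (lt_min ha hb).trans_le hs.1
  have hint : IntervalIntegrable (fun s : ℝ => C / s) volume a b :=
    ContinuousOn.intervalIntegrable
      (continuousOn_const.div continuousOn_id fun s hs => (hpos s hs).ne')
  refine hint.mono_fun' (measurable_integrand hf σ c α).aestronglyMeasurable ?_
  filter_upwards [ae_restrict_mem measurableSet_uIoc] with s hs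
  exact abs_integrand_le hC hσ c α (hpos s (uIoc_subset_uIcc hs))

lemma firstIndex_eq {α : ℝ} (hα : α ∈ unitIrrationals) {n : ℕ} {ε : ℝ}
    (h1 : dist α (n + 1) ≤ ε) (h2 : ε < dist α n) : firstIndex α ε = n + 1 := by
  refine le_antisymm (Nat.sInf_le h1) ?_
  by_contra! h
  have h3 : dist α (firstIndex α ε) ≤ ε := Nat.sInf_mem (s := {n | dist α n ≤ ε}) ⟨_, h1⟩
  have h4 := (dist_strictAnti hα).antitone (Nat.lt_succ_iff.1 h)
  linarith

/-- The scales `d_{n+1} ≤ ε < d_n`, where `n = m + j`, contribute the block integral at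
`T^j α`. -/
lemma integral_integrand_block (σ : ℝ) (c : ℕ → ℝ) {α : ℝ} (hα : α ∈ unitIrrationals) (j : ℕ) :
    ∫ ε in (dist α (m + j + 1))..(dist α (m + j)),
      σ ^ firstIndex α ε * f (window m c α ε) / ε =
      σ ^ (m + j + 1) * blockIntegral m f (gaussMap^[j] α) := by
  have hle : dist α (m + j + 1) ≤ dist α (m + j) :=
    (dist_strictAnti hα).antitone (Nat.le_succ _)
  set y := gaussMap^[j] α with hy
  have hyX : y ∈ unitIrrationals := iterate_gaussMap_mem hα j
  set r := orbitProd j α with hr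
  have hr0 : 0 < r := orbitProd_pos hα j
  have hd : ∀ k, dist α (j + k) = r * orbitProd k y := fun k => by
    rw [dist_eq_orbitProd hα, orbitProd_add]
  have hle' : orbitProd (m + 1) y ≤ orbitProd m y := by
    rw [← dist_eq_orbitProd hyX, ← dist_eq_orbitProd hyX]
    exact (dist_strictAnti hyX).antitone (Nat.le_succ _)
  have h1 : ∫ ε in (dist α (m + j + 1))..(dist α (m + j)),
      σ ^ firstIndex α ε * f (window m c α ε) / ε =
      ∫ ε in (dist α (m + j + 1))..(dist α (m + j)), σ ^ (m + j + 1) *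
        (f (fun i => r * orbitProd (m + 1 - i) y / ε) / ε) := by
    rw [intervalIntegral.integral_of_le hle, intervalIntegral.integral_of_le hle,
      integral_Ioc_eq_integral_Ioo, integral_Ioc_eq_integral_Ioo]
    refine setIntegral_congr_fun measurableSet_Ioo fun ε hε => ?_
    have hN := firstIndex_eq hα hε.1.le hε.2
    have hw : window m c α ε = fun i : Fin (m + 1) => r * orbitProd (m + 1 - i) y / ε := by
      funext i
      have hi := i.2
      have e1 : ((m + j + 1 : ℕ) : ℤ) - ((i : ℕ) : ℤ) =
          Int.ofNat (j + (m + 1 - i)) := by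
        rw [Int.ofNat_eq_natCast]; omega
      unfold window delta
      rw [hN, e1, ← hd]
      rfl
    simp only [hN, hw]
    rw [mul_div_assoc]
  rw [h1, intervalIntegral.integral_const_mul, show m + j + 1 = j + (m + 1) by ring,
    show m + j = j + m by ring, hd, hd, ← intervalIntegral.mul_integral_comp_mul_left]
  congr 1
  unfold blockIntegral
  rw [← intervalIntegral.integral_of_le hle', ← intervalIntegral.integral_const_mul]
  congr 1
  funext s
  rcases eq_or_ne s 0 with rfl | hs
  · simp
  · simp_rw [mul_div_mul_left _ _ hr0.ne']
    field_simp

/-- Between consecutive distances the integrals are block integrals, so the integral from `d_n` to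
`1` is, up to a bounded term, a weighted Birkhoff sum. -/
lemma tendsto_integral_integrand_div (hf : Measurable f) (hC : ∀ v, |f v| ≤ C) {σ ℓ : ℝ}
    (hσ : |σ| = 1) {α : ℝ} (hα : α ∈ unitIrrationals) (c : ℕ → ℝ)
    (hsum : Tendsto (fun n : ℕ => (∑ i ∈ Finset.range n,
      σ ^ (m + i + 1) * blockIntegral m f (gaussMap^[i] α)) / n) atTop (𝓝 ℓ)) :
    Tendsto (fun n : ℕ => (∫ ε in (dist α n)..1,
      σ ^ firstIndex α ε * f (window m c α ε) / ε) / n) atTop (𝓝 ℓ) := by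
  set h : ℝ → ℝ := fun ε => σ ^ firstIndex α ε * f (window m c α ε) / ε with hh
  have hint : ∀ {a b : ℝ}, 0 < a → 0 < b → IntervalIntegrable h volume a b :=
    fun ha hb => intervalIntegrable_integrand hf hC hσ c α ha hb
  have hA : ∀ j : ℕ, ∫ ε in (dist α (j + m))..1, h ε = (∫ ε in (dist α m)..1, h ε) +
      ∑ i ∈ Finset.range j, σ ^ (m + i + 1) * blockIntegral m f (gaussMap^[i] α) := fun j => by
    induction j with
    | zero => simp
    | succ j ih =>
      rw [Finset.sum_range_succ, ← add_assoc, ← ih, ← integral_integrand_block σ c hα j,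
        show j + 1 + m = m + j + 1 by ring, show j + m = m + j by ring, add_comm (∫ _ in _.._, _)]
      exact (intervalIntegral.integral_add_adjacent_intervals
        (hint (dist_pos hα _) (dist_pos hα _)) (hint (dist_pos hα _) one_pos)).symm
  rw [← tendsto_add_atTop_iff_nat m]
  have h1 : Tendsto (fun j : ℕ => (∫ ε in (dist α m)..1, h ε) / ((j + m : ℕ) : ℝ)) atTop (𝓝 0) :=
    (tendsto_const_div_atTop_nhds_zero_nat _).comp (tendsto_add_atTop_nat m)
  have h2 : Tendsto (fun j : ℕ => (j : ℝ) / (j + m : ℝ)) atTop (𝓝 1) :=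
    tendsto_natCast_div_add_atTop (m : ℝ)
  have h3 := h1.add (hsum.mul h2)
  rw [zero_add, mul_one] at h3
  refine h3.congr' ?_
  filter_upwards [eventually_gt_atTop 0] with j hj
  have : (j : ℝ) ≠ 0 := by exact_mod_cast hj.ne'
  have : (j : ℝ) + m ≠ 0 := by positivity
  rw [hA]
  push_cast
  field_simp

/-- The deterministic part of the argument. If along the orbit of `α` the averages of `-log` tend
to `lam > 0` and the averages of the (weighted) block integrals tend to `ℓ`, then both
`∫_η^1 … dε/ε` and `log (1/η)` are asymptotically linear in `N(α, η)`, with slopes `ℓ` and `lam`;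
the incomplete last block is negligible since `log T^n α = o(n)`. -/
theorem tendsto_logAverage (hf : Measurable f) (hC : ∀ v, |f v| ≤ C) {σ ℓ lam : ℝ}
    (hσ : |σ| = 1) (hlam : 0 < lam) {α : ℝ} (hα : α ∈ unitIrrationals) (c : ℕ → ℝ)
    (hlog : Tendsto (fun n : ℕ => birkhoffSum gaussMap (fun y => -Real.log y) n α / n)
      atTop (𝓝 lam))
    (hsum : Tendsto (fun n : ℕ => (∑ i ∈ Finset.range n,
      σ ^ (m + i + 1) * blockIntegral m f (gaussMap^[i] α)) / n) atTop (𝓝 ℓ)) :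
    Tendsto (fun η : ℝ => 1 / Real.log (1 / η) *
      ∫ ε in η..1, σ ^ firstIndex α ε * f (window m c α ε) / ε) (𝓝[>] 0) (𝓝 (ℓ / lam)) := by
  have hA := tendsto_integral_integrand_div hf hC hσ hα c hsum
  set h : ℝ → ℝ := fun ε => σ ^ firstIndex α ε * f (window m c α ε) / ε with hh
  have hint : ∀ {a b : ℝ}, 0 < a → 0 < b → IntervalIntegrable h volume a b :=
    fun ha hb => intervalIntegrable_integrand hf hC hσ c α ha hb
  set b : ℕ → ℝ := fun n => birkhoffSum gaussMap (fun y => -Real.log y) n α with hb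
  set e : ℕ → ℝ := fun n => -Real.log (gaussMap^[n] α) with he
  have hbe : ∀ n, b (n + 1) = b n + e n := fun n => birkhoffSum_succ _ _ _ _
  have hbd : ∀ n, Real.log (dist α n) = -b n := fun n => by
    rw [dist_eq_orbitProd hα, hb]
    simp only
    rw [← log_orbitProd hα, neg_neg]
  have hediv : Tendsto (fun n : ℕ => e n / ((n + 1 : ℕ) : ℝ)) atTop (𝓝 0) :=
    tendsto_div_of_tendsto_sum_div hlog
  have hbtop : Tendsto b atTop atTop := by
    refine (hlog.pos_mul_atTop hlam tendsto_natCast_atTop_atTop).congr' ?_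
    filter_upwards [eventually_gt_atTop 0] with n hn
    have : (n : ℝ) ≠ 0 := by exact_mod_cast hn.ne'
    rw [div_mul_cancel₀ _ this]
  have hex : ∀ η : ℝ, 0 < η → ∃ n, dist α n ≤ η := fun η hη => by
    obtain ⟨n, hn⟩ := (hbtop.eventually_ge_atTop (-Real.log η)).exists
    refine ⟨n, (Real.log_le_log_iff (dist_pos hα n) hη).1 ?_⟩
    rw [hbd]; linarith
  have hmem : ∀ η : ℝ, 0 < η → dist α (firstIndex α η) ≤ η := fun η hη =>
    Nat.sInf_mem (s := {n | dist α n ≤ η}) (hex η hη)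
  have hlt : ∀ {η : ℝ} {n : ℕ}, n < firstIndex α η → η < dist α n := fun {η n} hn =>
    not_le.1 fun hle => Nat.notMem_of_lt_sInf (s := {n | dist α n ≤ η}) hn hle
  set k : ℝ → ℕ := fun η => firstIndex α η - 1 with hk
  have hktop : Tendsto k (𝓝[>] 0) atTop := by
    refine tendsto_atTop.2 fun n => ?_
    filter_upwards [Ioo_mem_nhdsGT (dist_pos hα n)] with η hη
    have : n < firstIndex α η := by
      by_contra! hle
      have h1 := (dist_strictAnti hα).antitone hle
      linarith [hmem η hη.1, hη.2]
    simp only [hk]; omega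
  have hbounds : ∀ᶠ η : ℝ in 𝓝[>] 0, 0 < η ∧ dist α (k η + 1) ≤ η ∧ η < dist α (k η) := by
    filter_upwards [Ioo_mem_nhdsGT (one_pos : (0 : ℝ) < 1)] with η hη
    have h0 : firstIndex α η ≠ 0 := fun h0 => by
      have := hmem η hη.1
      rw [h0] at this
      simp [dist, den, num] at this
      linarith [hη.2]
    have h1 : k η + 1 = firstIndex α η := by simp only [hk]; omega
    exact ⟨hη.1, h1 ▸ hmem η hη.1, hlt (by omega)⟩
  have hI : Tendsto (fun η => (∫ ε in η..1, h ε) / ((k η + 1 : ℕ) : ℝ)) (𝓝[>] 0) (𝓝 ℓ) := by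
    have h1 : Tendsto (fun η => (∫ ε in (dist α (k η + 1))..1, h ε) / ((k η + 1 : ℕ) : ℝ))
        (𝓝[>] 0) (𝓝 ℓ) := hA.comp ((tendsto_add_atTop_nat 1).comp hktop)
    have h2 : Tendsto (fun η => C * (e (k η) / ((k η + 1 : ℕ) : ℝ))) (𝓝[>] 0) (𝓝 0) := by
      simpa using (hediv.comp hktop).const_mul C
    refine (tendsto_iff_of_dist ?_).1 h1
    refine squeeze_zero' (Eventually.of_forall fun η => dist_nonneg) ?_ h2
    filter_upwards [hbounds] with η ⟨h0, hle, hltη⟩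
    have hC0 : 0 ≤ C := (abs_nonneg _).trans (hC 0)
    rw [Real.dist_eq, ← sub_div, abs_div, Nat.abs_cast, ← mul_div_assoc]
    refine div_le_div_of_nonneg_right ?_ (Nat.cast_nonneg _)
    have hd := dist_pos hα (k η + 1)
    rw [← intervalIntegral.integral_add_adjacent_intervals (hint hd h0) (hint h0 one_pos),
      add_sub_cancel_right]
    refine (abs_intervalIntegral_le_log (C := C) hd hle fun s hs =>
      abs_integrand_le hC hσ c α (hd.trans hs.1)).trans (mul_le_mul_of_nonneg_left ?_ hC0)
    have := Real.log_le_log h0 hltη.le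
    rw [hbd] at this ⊢
    linarith [hbe (k η)]
  have hL : Tendsto (fun η => Real.log (1 / η) / ((k η + 1 : ℕ) : ℝ)) (𝓝[>] 0) (𝓝 lam) := by
    have h1 : Tendsto (fun η => b (k η + 1) / ((k η + 1 : ℕ) : ℝ)) (𝓝[>] 0) (𝓝 lam) :=
      hlog.comp ((tendsto_add_atTop_nat 1).comp hktop)
    have h2 : Tendsto (fun η => e (k η) / ((k η + 1 : ℕ) : ℝ)) (𝓝[>] 0) (𝓝 0) :=
      hediv.comp hktop
    have h3 := h1.sub h2
    rw [sub_zero] at h3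
    refine tendsto_of_tendsto_of_tendsto_of_le_of_le' h3 h1 ?_ ?_
    · filter_upwards [hbounds] with η ⟨h0, hle, hltη⟩
      rw [← sub_div, one_div, Real.log_inv]
      refine div_le_div_of_nonneg_right ?_ (Nat.cast_nonneg _)
      have := Real.log_le_log h0 hltη.le
      rw [hbd] at this
      linarith [hbe (k η)]
    · filter_upwards [hbounds] with η ⟨h0, hle, hltη⟩
      rw [one_div, Real.log_inv]
      refine div_le_div_of_nonneg_right ?_ (Nat.cast_nonneg _)
      have := Real.log_le_log (dist_pos hα _) hle
      rw [hbd] at this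
      linarith
  refine (hI.div hL hlam.ne').congr fun η => ?_
  have hk0 : ((k η + 1 : ℕ) : ℝ) ≠ 0 := by positivity
  simp only [Pi.div_apply]
  rw [div_div_div_cancel_right₀ hk0, one_div_mul_eq_div]

/-- The two limits for a bounded measurable function on the whole of `ℝ^(m+1)`. -/
theorem ae_tendsto_logAverage (hf : Measurable f) (hC : ∀ v, |f v| ≤ C) :
    ∀ᵐ α ∂(volume.restrict (Ioo (0 : ℝ) 1)), α ∈ unitIrrationals ∧ ∀ c : ℕ → ℝ,
      Tendsto (fun η : ℝ => 1 / Real.log (1 / η) *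
        ∫ ε in η..1, (1 : ℝ) ^ firstIndex α ε * f (window m c α ε) / ε) (𝓝[>] 0)
        (𝓝 ((∫ x, blockIntegral m f x ∂gaussMeasure) / ∫ x, -Real.log x ∂gaussMeasure)) ∧
      Tendsto (fun η : ℝ => 1 / Real.log (1 / η) *
        ∫ ε in η..1, (-1 : ℝ) ^ firstIndex α ε * f (window m c α ε) / ε) (𝓝[>] 0) (𝓝 0) := by
  rw [ae_volume_iff_ae_gaussMeasure]
  have hT : Ergodic gaussMap gaussMeasure := ergodic_iterate_gaussMap one_pos
  have hFm := measurable_blockIntegral hf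
  have hFi := integrable_blockIntegral hf hC
  filter_upwards [ae_mem_unitIrrationals,
    ae_tendsto_birkhoffSum_div hT Real.measurable_log.neg integrable_neg_log,
    ae_tendsto_birkhoffSum_div hT hFm hFi,
    ae_tendsto_alternating_birkhoffSum_div measurePreserving_gaussMap
      (ergodic_iterate_gaussMap two_pos) hFm hFi] with α hα h1 h2 h3
  refine ⟨hα, fun c => ⟨?_, ?_⟩⟩
  · exact tendsto_logAverage hf hC abs_one integral_neg_log_pos hα c h1
      (by simpa only [one_pow, one_mul, birkhoffSum] using h2)
  · have h4 := h3.const_mul ((-1 : ℝ) ^ (m + 1))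
    rw [mul_zero] at h4
    have h5 := tendsto_logAverage hf hC (σ := -1) (ℓ := 0) (by simp) integral_neg_log_pos hα c h1
      (h4.congr fun n => by
        rw [← mul_div_assoc, Finset.mul_sum]
        congr 1
        refine Finset.sum_congr rfl fun i _ => ?_
        rw [← mul_assoc, ← pow_add, show m + 1 + i = m + i + 1 by ring])
    rwa [zero_div] at h5

lemma window_nonneg {c : ℕ → ℝ} (hc : ∀ k, 0 ≤ c k) (α : ℝ) {ε : ℝ} (hε : 0 < ε)
    (i : Fin (m + 1)) : 0 ≤ window m c α ε i := by
  refine div_nonneg ?_ hε.le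
  cases (firstIndex α ε : ℤ) - ((i : ℕ) : ℤ) with
  | ofNat n => exact abs_nonneg _
  | negSucc k => exact hc k

end ContFracErgodic

theorem theorem5p2 (m : ℕ) (f : (Fin (m + 1) → ℝ) → ℝ)
    (hmeas : Measurable (fun x : {x : Fin (m + 1) → ℝ // ∀ i, 0 ≤ x i} => f x))
    (hbdd : ∃ C : ℝ, ∀ x : Fin (m + 1) → ℝ, (∀ i, 0 ≤ x i) → |f x| ≤ C) :
    ∃ L : ℝ, ∀ᵐ α ∂(volume.restrict (Set.Ioo (0 : ℝ) 1)),
      -- `c` gives arbitrary nonnegative values to `d_n(α)` for `n < 0`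
      ∀ c : ℕ → ℝ, (∀ k, 0 ≤ c k) →
        (∀ η ∈ Set.Ioo (0 : ℝ) 1,
          IntervalIntegrable
            (fun ε => f (ContFracErgodic.window m c α ε) / ε) volume η 1 ∧
          IntervalIntegrable
            (fun ε => (-1 : ℝ) ^ ContFracErgodic.firstIndex α ε *
              f (ContFracErgodic.window m c α ε) / ε) volume η 1) ∧
        Tendsto
          (fun η : ℝ => 1 / Real.log (1 / η) *
            ∫ ε in η..1, f (ContFracErgodic.window m c α ε) / ε)
          (𝓝[>] 0) (𝓝 L) ∧
        Tendsto
          (fun η : ℝ => 1 / Real.log (1 / η) *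
            ∫ ε in η..1, (-1 : ℝ) ^ ContFracErgodic.firstIndex α ε *
              f (ContFracErgodic.window m c α ε) / ε)
          (𝓝[>] 0) (𝓝 0) := by
  obtain ⟨C, hC⟩ := hbdd
  -- extend `f` from the positive orthant to the whole space by clamping the coordinates at zero
  set g : (Fin (m + 1) → ℝ) → ℝ := fun x => f fun i => max (x i) 0 with hg
  have hgm : Measurable g := by
    have h : Measurable fun x : Fin (m + 1) → ℝ =>
        (⟨fun i => max (x i) 0, fun i => le_max_right _ _⟩ :
          {x : Fin (m + 1) → ℝ // ∀ i, 0 ≤ x i}) :=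
      Measurable.subtype_mk (measurable_pi_lambda _ fun i =>
        (measurable_pi_apply i).max measurable_const)
    exact hmeas.comp h
  have hgC : ∀ x, |g x| ≤ C := fun x => hC _ fun i => le_max_right _ _
  have hgf : ∀ {c : ℕ → ℝ}, (∀ k, 0 ≤ c k) → ∀ (α : ℝ) {ε : ℝ}, 0 < ε →
      g (ContFracErgodic.window m c α ε) = f (ContFracErgodic.window m c α ε) :=
    fun {c} hc α {ε} hε => by
      simp only [hg]
      congr 1
      funext i
      exact max_eq_left (ContFracErgodic.window_nonneg hc α hε i)
  refine ⟨(∫ x, ContFracErgodic.blockIntegral m g x ∂ContFracErgodic.gaussMeasure) /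
    ∫ x, -Real.log x ∂ContFracErgodic.gaussMeasure, ?_⟩
  filter_upwards [ContFracErgodic.ae_tendsto_logAverage hgm hgC] with α ⟨hα, hlim⟩ c hc
  have hpos : ∀ {η : ℝ}, η ∈ Ioo (0 : ℝ) 1 → ∀ ε ∈ uIcc η 1, 0 < ε := fun hη ε hε => by
    rw [uIcc_of_le hη.2.le] at hε
    exact hη.1.trans_le hε.1
  have hone : ∀ {η : ℝ}, η ∈ Ioo (0 : ℝ) 1 → EqOn
      (fun ε => (1 : ℝ) ^ ContFracErgodic.firstIndex α ε *
        g (ContFracErgodic.window m c α ε) / ε)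
      (fun ε => f (ContFracErgodic.window m c α ε) / ε) (uIcc η 1) := fun hη ε hε => by
    simp only [one_pow, one_mul, hgf hc α (hpos hη ε hε)]
  have hneg : ∀ {η : ℝ}, η ∈ Ioo (0 : ℝ) 1 → EqOn
      (fun ε => (-1 : ℝ) ^ ContFracErgodic.firstIndex α ε *
        g (ContFracErgodic.window m c α ε) / ε)
      (fun ε => (-1 : ℝ) ^ ContFracErgodic.firstIndex α ε *
        f (ContFracErgodic.window m c α ε) / ε) (uIcc η 1) := fun hη ε hε => by
    simp only [hgf hc α (hpos hη ε hε)]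
  obtain ⟨h1, h2⟩ := hlim c
  refine ⟨fun η hη => ⟨?_, ?_⟩, h1.congr' ?_, h2.congr' ?_⟩
  · exact (ContFracErgodic.intervalIntegrable_integrand hgm hgC abs_one c α hη.1 one_pos).congr
      ((hone hη).mono uIoc_subset_uIcc)
  · exact (ContFracErgodic.intervalIntegrable_integrand hgm hgC (σ := -1) (by simp) c α hη.1
      one_pos).congr ((hneg hη).mono uIoc_subset_uIcc)
  · filter_upwards [Ioo_mem_nhdsGT (one_pos : (0 : ℝ) < 1)] with η hη
    rw [intervalIntegral.integral_congr (hone hη)]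
  · filter_upwards [Ioo_mem_nhdsGT (one_pos : (0 : ℝ) < 1)] with η hη
    rw [intervalIntegral.integral_congr (hneg hη)]
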